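/- Let $d\in\mathbb N$ and $0<\gamma<d$. Let $|p|^\gamma=(-\Delta)^{\gamma/2}$, $p=-i\nabla$, act on $L^2(\mathbb R^d)$, and let $V:\mathbb R^d\to\mathbb R$ be a measurable potential that is relatively form compact with respect to $|p|^\gamma$, that is, $(|p|^\gamma+1)^{-1/2}|V|(|p|^\gamma+1)^{-1/2}$ (understood in the sense of quadratic forms) is a compact operator on $L^2(\mathbb R^d)$. Let $|p|^\gamma+V$ be the operator defined by the sum of the quadratic forms on the form domain of $|p|^\gamma$, and let $N(|p|^\gamma+V)$ be the number of its strictly negative eigenvalues, counted with multiplicity. Then $$N(|p|^\gamma+V)\le\Big(\frac{4d}{d-\gamma}\Big)^{2d/\gamma}\,\frac{d(d-\gamma)}{(4\gamma)^2}\,\frac{|B_1^d|}{(2\pi)^d}\int_{\mathbb R^d}V_-(x)^{d/\gamma}\,dx ,$$ where $V_-=\max(0,-V)$, $|B_1^d|$ is the volume of the unit ball in $\mathbb R^d$, and the right-hand side is $+\infty$ if the integral diverges. -/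

import Mathlib

open MeasureTheory FourierTransform
open scoped ENNReal InnerProductSpace

noncomputable section

namespace BoundStates

/-- Euclidean space `ℝ^d`. -/
abbrev Space (d : ℕ) : Type := EuclideanSpace ℝ (Fin d)

/-- The complex Hilbert space `L²(ℝ^d)`. -/
abbrev L2 (d : ℕ) : Type := Lp (α := Space d) ℂ 2

variable {d : ℕ}

/-- The maximal operator of multiplication by the real function `m` in `L²(ℝ^d)`:
its domain consists of all `φ ∈ L²` with `m φ ∈ L²`. -/
def mulOp (m : Space d → ℝ) : L2 d →ₗ.[ℂ] L2 d where
  domain :=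
    { carrier := {φ | MemLp (fun x => (m x : ℂ) * φ x) 2 volume}
      add_mem' := by
        intro φ ψ hφ hψ
        refine (hφ.add hψ).ae_eq ?_
        filter_upwards [Lp.coeFn_add φ ψ] with x hx
        rw [hx]
        simp only [Pi.add_apply, mul_add]
      zero_mem' := by
        refine (MemLp.zero (α := Space d) (ε := ℂ) (p := 2) (μ := volume)).ae_eq ?_
        filter_upwards [Lp.coeFn_zero ℂ 2 (volume : Measure (Space d))] with x hx
        rw [hx]
        simp only [Pi.zero_apply, mul_zero]
      smul_mem' := by
        intro c φ hφ
        refine (hφ.const_mul c).ae_eq ?_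
        filter_upwards [Lp.coeFn_smul c φ] with x hx
        rw [hx]
        simp only [Pi.smul_apply, smul_eq_mul, mul_left_comm] }
  toFun :=
    { toFun := fun φ => MemLp.toLp (fun x => (m x : ℂ) * (φ : L2 d) x) φ.2
      map_add' := by
        intro φ ψ
        apply Lp.ext
        refine (MemLp.coeFn_toLp _).trans ?_
        refine Filter.EventuallyEq.trans ?_ (Lp.coeFn_add _ _).symm
        filter_upwards [Lp.coeFn_add (φ : L2 d) ψ, MemLp.coeFn_toLp φ.2,
          MemLp.coeFn_toLp ψ.2] with x h1 h2 h3
        rw [Pi.add_apply, h2, h3, Submodule.coe_add, h1, Pi.add_apply, mul_add]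
      map_smul' := by
        intro c φ
        apply Lp.ext
        refine (MemLp.coeFn_toLp _).trans ?_
        refine Filter.EventuallyEq.trans ?_ (Lp.coeFn_smul _ _).symm
        filter_upwards [Lp.coeFn_smul c (φ : L2 d), MemLp.coeFn_toLp φ.2] with x h1 h2
        simp [h1, h2, mul_left_comm] }

/-- The Fourier multiplier `m(p)`, `p = -i∇`, on its maximal domain. Mathlib's unitary Fourier
transform `𝓕` on `L²` has the kernel `exp (-2πi ⟨x, ξ⟩)`, so that `p` becomes multiplication by
`2πξ`, and `m(p) φ = 𝓕⁻¹ [m(2π ·) 𝓕 φ]`. In terms of the unitary Fourier transform with kernel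
`(2π)^(-d/2) exp (-i ⟨x, η⟩)` this is the operator of multiplication by `m(η)`. -/
def fourierMultiplier (m : Space d → ℝ) : L2 d →ₗ.[ℂ] L2 d where
  domain := (mulOp fun ξ => m ((2 * Real.pi) • ξ)).domain.comap
    (Lp.fourierTransformₗᵢ (Space d) ℂ).toLinearEquiv.toLinearMap
  toFun := (Lp.fourierTransformₗᵢ (Space d) ℂ).symm.toLinearEquiv.toLinearMap ∘ₗ
    (mulOp fun ξ => m ((2 * Real.pi) • ξ)).toFun ∘ₗ
      (Lp.fourierTransformₗᵢ (Space d) ℂ).toLinearEquiv.toLinearMap.submoduleComap _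

/-- The operator `√T(p)`; its domain is the form domain `𝒬(T(p))`. -/
def sqrtKinetic (T : Space d → ℝ) : L2 d →ₗ.[ℂ] L2 d :=
  fourierMultiplier fun η => √(T η)

/-- Multiplication by `√V₊`, where `V₊ = max(0, V)`. -/
def sqrtPos (V : Space d → ℝ) : L2 d →ₗ.[ℂ] L2 d := mulOp fun x => √(max 0 (V x))

/-- Multiplication by `√V₋`, where `V₋ = max(0, -V)`. -/
def sqrtNeg (V : Space d → ℝ) : L2 d →ₗ.[ℂ] L2 d := mulOp fun x => √(max 0 (-V x))

/-- Multiplication by `|V|^{1/2}`; its domain is `𝒬(V)`. -/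
def sqrtAbs (V : Space d → ℝ) : L2 d →ₗ.[ℂ] L2 d := mulOp fun x => √|V x|

/-- The operator `(T(p) + 1)^{-1/2}`; it is bounded and everywhere defined for a nonnegative
measurable symbol `T`. -/
def invSqrtKineticAddOne (T : Space d → ℝ) : L2 d →ₗ.[ℂ] L2 d :=
  fourierMultiplier fun η => (√(T η + 1))⁻¹

/-- The potential `V` is relatively form compact with respect to `T(p)`: the operator
`(T(p) + 1)^{-1/2} |V| (T(p) + 1)^{-1/2}`, understood through its quadratic form, is a (bounded,
everywhere defined and) compact operator `K` on `L²(ℝ^d)`. In particular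
`𝒬(T(p)) = Ran (T(p) + 1)^{-1/2}` is contained in `𝒬(V)`. -/
def IsRelFormCompact (T V : Space d → ℝ) : Prop :=
  ∃ K : L2 d →L[ℂ] L2 d, IsCompactOperator K ∧
    ∀ f g : (invSqrtKineticAddOne T).domain,
      ∃ (hf : invSqrtKineticAddOne T f ∈ (sqrtAbs V).domain)
        (hg : invSqrtKineticAddOne T g ∈ (sqrtAbs V).domain),
        ⟪(f : L2 d), K g⟫_ℂ = ⟪sqrtAbs V ⟨_, hf⟩, sqrtAbs V ⟨_, hg⟩⟫_ℂ

/-- The domain `𝒬(T(p)) ∩ 𝒬(V)` of the quadratic form of `T(p) + V`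
(it equals `𝒬(T(p))` if `V` is relatively form compact with respect to `T(p)`). -/
def formDomain (T V : Space d → ℝ) : Submodule ℂ (L2 d) :=
  (sqrtKinetic T).domain ⊓ ((sqrtPos V).domain ⊓ (sqrtNeg V).domain)

/-- The sesquilinear form of `T(p) + V`,
`⟨√T(p) φ, √T(p) ψ⟩ + ∫ V₊ φ̄ ψ dx - ∫ V₋ φ̄ ψ dx`. -/
def form (T V : Space d → ℝ) (φ ψ : formDomain T V) : ℂ :=
  ⟪sqrtKinetic T ⟨φ, φ.2.1⟩, sqrtKinetic T ⟨ψ, ψ.2.1⟩⟫_ℂ +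
    ⟪sqrtPos V ⟨φ, φ.2.2.1⟩, sqrtPos V ⟨ψ, ψ.2.2.1⟩⟫_ℂ -
    ⟪sqrtNeg V ⟨φ, φ.2.2.2⟩, sqrtNeg V ⟨ψ, ψ.2.2.2⟩⟫_ℂ

lemma form_add (T V : Space d → ℝ) (φ ψ χ : formDomain T V) :
    form T V φ (ψ + χ) = form T V φ ψ + form T V φ χ := by
  have h1 := (sqrtKinetic T).map_add ⟨ψ, ψ.2.1⟩ ⟨χ, χ.2.1⟩
  have h2 := (sqrtPos V).map_add ⟨ψ, ψ.2.2.1⟩ ⟨χ, χ.2.2.1⟩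
  have h3 := (sqrtNeg V).map_add ⟨ψ, ψ.2.2.2⟩ ⟨χ, χ.2.2.2⟩
  simp only [AddMemClass.mk_add_mk] at h1 h2 h3
  simp only [form, Submodule.coe_add, h1, h2, h3, inner_add_right]
  ring

lemma form_smul (T V : Space d → ℝ) (c : ℂ) (φ ψ : formDomain T V) :
    form T V φ (c • ψ) = c * form T V φ ψ := by
  have h1 := (sqrtKinetic T).map_smul c ⟨ψ, ψ.2.1⟩
  have h2 := (sqrtPos V).map_smul c ⟨ψ, ψ.2.2.1⟩
  have h3 := (sqrtNeg V).map_smul c ⟨ψ, ψ.2.2.2⟩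
  simp only [SetLike.mk_smul_mk] at h1 h2 h3
  simp only [form, Submodule.coe_smul, h1, h2, h3, inner_smul_right]
  ring

/-- The graph of the operator `H = T(p) + V` associated with the form `q` of `T(p) + V` by the
representation theorem: `ψ` is in the domain of `H` and `H ψ = h` iff `ψ` is in the form domain
and `q(φ, ψ) = ⟨φ, h⟩` for all `φ` in the form domain. (For a dense form domain, `h` is unique.) -/
def schrodingerGraph (T V : Space d → ℝ) : Submodule ℂ (L2 d × L2 d) where
  carrier := {z | ∃ hψ : z.1 ∈ formDomain T V,
    ∀ φ : formDomain T V, form T V φ ⟨z.1, hψ⟩ = ⟪(φ : L2 d), z.2⟫_ℂ}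
  add_mem' := by
    rintro z w ⟨hz, hz'⟩ ⟨hw, hw'⟩
    refine ⟨Submodule.add_mem _ hz hw, fun φ => ?_⟩
    have h := form_add T V φ ⟨z.1, hz⟩ ⟨w.1, hw⟩
    rw [hz', hw', ← inner_add_right] at h
    exact h
  zero_mem' := by
    refine ⟨Submodule.zero_mem _, fun φ => ?_⟩
    have h := form_smul T V 0 φ 0
    rw [zero_smul, zero_mul] at h
    rw [Prod.snd_zero, inner_zero_right]
    exact h
  smul_mem' := by
    rintro c z ⟨hz, hz'⟩
    refine ⟨Submodule.smul_mem _ c hz, fun φ => ?_⟩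
    have h := form_smul T V c φ ⟨z.1, hz⟩
    rw [hz', ← inner_smul_right] at h
    exact h

/-- The eigenspace of `T(p) + V` for the real number `E`: all `ψ` in the domain of the operator
with `(T(p) + V) ψ = E ψ`. -/
def eigenspace (T V : Space d → ℝ) (E : ℝ) : Submodule ℂ (L2 d) :=
  (schrodingerGraph T V).comap (LinearMap.prod LinearMap.id ((E : ℂ) • LinearMap.id))

/-- `N(T(p) + V)`: the number of strictly negative eigenvalues of `T(p) + V`, counted with
multiplicity, as an element of `[0, ∞]`. -/
def numNegEigenvalues (T V : Space d → ℝ) : ℝ≥0∞ :=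
  ∑' E : {E : ℝ // E < 0}, ((Cardinal.toENat (Module.rank ℂ (eigenspace T V E)) : ℕ∞) : ℝ≥0∞)

end BoundStates

end

/-! The proof is Cwikel's method in variational form. On the span `W` of finitely many orthonormal
eigenfunctions with negative eigenvalues the form is negative, so `‖√T(p) w‖ < ‖√V₋ w‖` for nonzero
`w` in `W`. As `√T(p)` is injective, an orthonormal basis `e i` of `√T(p) W` has as many members as
there are eigenfunctions. With `f = √V₋` and `G = √T`, each `e i` satisfies `‖f(x) G(p)⁻¹ e i‖ ≥ 1`;
it remains to count such vectors (`card_le_tsum_dyadic`).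

Where `f` is of size `2 ^ k`, frequencies are split at `a G = 2 ^ k`. By Plancherel, the high parts
together have norm at most `2 a`, because the powers `4 ^ k` with `2 ^ k ≤ a G` sum to at most `4 (a
G)²` (`tsum_lintegral_cutoff_compl_le`). Each low part therefore keeps norm at least `1 - 2 a`. By
Bessel, the sum over `i` of the squared low parts is at almost every point at most `∫ G⁻²` over `a G
< 2 ^ k`, however many `i` there are (`ae_sum_enorm_cutoff_le`). For `G = |p|^(γ/2)` this integral
is a power of `2 ^ k < 2 f`, which produces `∫ f ^ (2d/γ)`. -/

namespace BoundStates

variable {d : ℕ}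

/-! ### Frequency cutoffs and the Fourier integral -/

/-- Multiplication of an `L²` function by the indicator function of a measurable set. -/
noncomputable def cutoff (S : Set (Space d)) (hS : MeasurableSet S) (u : L2 d) : L2 d :=
  ((Lp.memLp u).indicator hS).toLp

lemma coeFn_cutoff (S : Set (Space d)) (hS : MeasurableSet S) (u : L2 d) :
    cutoff S hS u =ᵐ[volume] S.indicator u :=
  MemLp.coeFn_toLp _

lemma cutoff_add_cutoff_compl (S : Set (Space d)) (hS : MeasurableSet S) (u : L2 d) :
    cutoff S hS u + cutoff Sᶜ hS.compl u = u := by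
  apply Lp.ext
  filter_upwards [Lp.coeFn_add (cutoff S hS u) (cutoff Sᶜ hS.compl u), coeFn_cutoff S hS u,
    coeFn_cutoff Sᶜ hS.compl u] with x h1 h2 h3
  rw [h1, Pi.add_apply, h2, h3, Set.indicator_self_add_compl_apply]

lemma lintegral_enorm_sq (v : L2 d) : ∫⁻ x, ‖v x‖ₑ ^ 2 = ‖v‖ₑ ^ 2 := by
  rw [Lp.enorm_def, eLpNorm_eq_lintegral_rpow_enorm_toReal (by norm_num) (by norm_num)]
  simp only [ENNReal.toReal_ofNat, ENNReal.rpow_ofNat]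
  rw [← ENNReal.rpow_natCast, ← ENNReal.rpow_mul]
  norm_num

/-- On `L¹ ∩ L²` the inverse Fourier transform is given by the Fourier integral. -/
lemma coeFn_fourierTransform_symm (u : L2 d) (hu : Integrable u volume) :
    (Lp.fourierTransformₗᵢ (Space d) ℂ).symm u =ᵐ[volume] 𝓕⁻ (u : Space d → ℂ) := by
  have hc : Continuous (𝓕⁻ (u : Space d → ℂ)) := by
    have := (Real.Lp.fourierTransformInv (memLp_one_iff_integrable.2 hu).toLp).continuous
    rwa [Real.Lp.fourierTransformInv_toLp] at this
  -- Both sides are tested against smooth compactly supported functions, for which the `L²`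
  -- transform agrees with the distributional one.
  refine ae_eq_of_integral_contDiff_smul_eq ((Lp.memLp _).locallyIntegrable (by norm_num))
    hc.locallyIntegrable fun g hg hgc => ?_
  have hg₁ : HasCompactSupport (Complex.ofRealCLM ∘ g) := hgc.comp_left rfl
  have hg₂ : ContDiff ℝ (⊤ : ℕ∞) (Complex.ofRealCLM ∘ g) := by fun_prop
  let G : SchwartzMap (Space d) ℂ := hg₁.toSchwartzMap hg₂
  have hG : ∀ x, G x = (g x : ℂ) := fun x => rfl
  have key := congrArg (fun D => D G) (Lp.fourierInv_toTemperedDistribution_eq u)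
  simp only [TemperedDistribution.fourierInv_apply, Lp.toTemperedDistribution_apply] at key
  have flip : ∫ x, 𝓕⁻ G x • u x = ∫ x, G x • 𝓕⁻ (u : Space d → ℂ) x := by
    have := VectorFourier.integral_fourierIntegral_smul_eq_flip (μ := volume) (ν := volume)
      (L := -innerₗ (Space d)) (f := G) (g := u) Real.continuous_fourierChar
      (by simp only [LinearMap.neg_apply, innerₗ_apply_apply]; fun_prop) G.integrable hu
    have hflip : (-innerₗ (Space d)).flip = -innerₗ (Space d) := by
      ext x y
      simp [real_inner_comm]
    rw [hflip] at this
    rw [SchwartzMap.fourierInv_coe]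
    exact this
  calc _ = ∫ x, G x • (𝓕⁻ u : L2 d) x := by
        simp [hG]; rfl
    _ = _ := by rw [← key, flip]; simp [hG]

/-! ### Bessel's inequality, a dyadic sum and a radial integral -/

/-- Bessel's inequality for the integrals of an orthonormal family against an `L²` function. -/
lemma sum_enorm_integral_mul_sq_le {ι : Type*} [Fintype ι] {e : ι → L2 d} (he : Orthonormal ℂ e)
    {k : Space d → ℂ} (hk : MemLp k 2 volume) :
    ∑ i, ‖∫ ξ, k ξ * e i ξ‖ₑ ^ 2 ≤ ∫⁻ ξ, ‖k ξ‖ₑ ^ 2 := by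
  -- The conjugate compensates for the inner product being conjugate linear in its first argument.
  have hk' : MemLp (fun ξ => star (k ξ)) 2 volume := hk.star
  have hi : ∀ i, ∫ ξ, k ξ * e i ξ = ⟪hk'.toLp, e i⟫_ℂ := by
    intro i
    rw [L2.inner_def]
    refine integral_congr_ae ?_
    filter_upwards [hk'.coeFn_toLp] with ξ h
    rw [h]
    simp [mul_comm]
  have hn : ∫⁻ ξ, ‖k ξ‖ₑ ^ 2 = ‖hk'.toLp‖ₑ ^ 2 := by
    rw [← lintegral_enorm_sq]
    refine lintegral_congr_ae ?_
    filter_upwards [hk'.coeFn_toLp] with ξ h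
    rw [h]
    simp [enorm_eq_nnnorm]
  have := he.sum_inner_products_le hk'.toLp (s := Finset.univ)
  rw [hn]
  simp only [hi, ← ofReal_norm, ← ENNReal.ofReal_pow (norm_nonneg _)]
  rw [← ENNReal.ofReal_sum_of_nonneg (fun _ _ => by positivity)]
  refine ENNReal.ofReal_le_ofReal (le_trans (le_of_eq ?_) this)
  exact Finset.sum_congr rfl fun i _ => by rw [norm_inner_symm]

/-- The sum of the powers `4 ^ k` over the integers `k` with `2 ^ k ≤ y`. -/
lemma tsum_four_zpow_le (y : ℝ) (hy : 0 ≤ y) :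
    ∑' k : ℤ, (if (2 : ℝ) ^ k ≤ y then ENNReal.ofReal (4 ^ k) else 0) ≤
      ENNReal.ofReal (4 * y ^ 2) := by
  rcases hy.eq_or_lt with rfl | hy
  · have : ∀ k : ℤ, ¬ (2 : ℝ) ^ k ≤ 0 := fun k => not_le.2 (by positivity)
    simp [this]
  -- `m` is the largest contributing exponent. Writing `k = m - j` bounds the sum by a geometric
  -- series with value `4 / 3 * 4 ^ m`; the factor `4 / 3` is then relaxed to `4`.
  set m : ℤ := Int.log 2 y
  have hm : (2 : ℝ) ^ m ≤ y := by exact_mod_cast Int.zpow_log_le_self (b := 2) (by norm_num) hy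
  have hk : ∀ k : ℤ, (2 : ℝ) ^ k ≤ y → k ≤ m := fun k hk =>
    (Int.zpow_le_iff_le_log (b := 2) (by norm_num) hy).1 (by exact_mod_cast hk)
  have hinj : Function.Injective fun j : ℕ => m - j := fun a b h => by simpa using h
  rw [← hinj.tsum_eq]
  · calc _ ≤ ∑' j : ℕ, ENNReal.ofReal (4 ^ m) * (4 : ℝ≥0∞)⁻¹ ^ j := by
          refine ENNReal.tsum_le_tsum fun j => ?_
          split_ifs
          · rw [zpow_sub₀ (by norm_num), div_eq_mul_inv, ENNReal.ofReal_mul (by positivity),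
              zpow_natCast, ENNReal.ofReal_inv_of_pos (by positivity),
              ENNReal.ofReal_pow (by norm_num), ENNReal.inv_pow]
            simp
          · exact zero_le
      _ = ENNReal.ofReal (4 ^ m) * ENNReal.ofReal (4 / 3) := by
          rw [ENNReal.tsum_mul_left, ENNReal.tsum_geometric]
          congr 1
          have h4 : (4 : ℝ≥0∞)⁻¹ = ENNReal.ofReal (1 / 4) := by
            rw [one_div, ENNReal.ofReal_inv_of_pos (by norm_num)]
            simp
          rw [h4, ← ENNReal.ofReal_one, ← ENNReal.ofReal_sub _ (by norm_num),
            ← ENNReal.ofReal_inv_of_pos (by norm_num)]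
          norm_num
      _ ≤ _ := by
          rw [← ENNReal.ofReal_mul (by positivity)]
          refine ENNReal.ofReal_le_ofReal ?_
          have : (4 : ℝ) ^ m = (2 ^ m) ^ 2 := by
            rw [← zpow_natCast, zpow_comm]
            norm_num
          rw [this]
          have : ((2 : ℝ) ^ m) ^ 2 ≤ y ^ 2 := by gcongr
          nlinarith [sq_nonneg y]
  · intro k hk'
    simp only [Function.mem_support, ne_eq, ite_eq_right_iff, not_forall] at hk'
    obtain ⟨h, -⟩ := hk'
    exact ⟨(m - k).toNat, by have := hk k h; simp [this]⟩

/-- The integral of `|2πξ|^(-γ)` over the ball `|2πξ| < R`. -/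
lemma lintegral_norm_rpow_neg_ball (γ : ℝ) (hγd : γ < d) (hd : 0 < d) {R : ℝ} (hR : 0 < R) :
    ∫⁻ ξ in {ξ : Space d | ‖(2 * Real.pi) • ξ‖ < R},
        ENNReal.ofReal (‖(2 * Real.pi) • ξ‖ ^ (-γ)) =
      ENNReal.ofReal ((d : ℝ) / (d - γ) *
        (volume.real (Metric.ball (0 : Space d) 1) / (2 * Real.pi) ^ d) * R ^ (d - γ)) := by
  have : Nonempty (Fin d) := ⟨⟨0, hd⟩⟩
  have hpi : 0 < 2 * Real.pi := by positivity
  set ρ := R / (2 * Real.pi) with hρ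
  have hρ0 : 0 < ρ := by positivity
  -- The ball cutoff is put into the radial profile so that polar coordinates apply on the whole
  -- space.
  let g : ℝ → ℝ := (Set.Iio ρ).indicator fun r => (2 * Real.pi * r) ^ (-γ)
  have hnorm : ∀ ξ : Space d, ‖(2 * Real.pi) • ξ‖ = 2 * Real.pi * ‖ξ‖ := fun ξ => by
    rw [norm_smul, Real.norm_of_nonneg hpi.le]
  have hS : ∀ ξ : Space d, ‖(2 * Real.pi) • ξ‖ < R ↔ ‖ξ‖ < ρ := fun ξ => by
    rw [hnorm, hρ, lt_div_iff₀' hpi]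
  have hmeas : MeasurableSet {ξ : Space d | ‖(2 * Real.pi) • ξ‖ < R} :=
    (isOpen_lt (by fun_prop) continuous_const).measurableSet
  have hint : ∀ y ∈ Set.Ioi (0 : ℝ), y ^ (Module.finrank ℝ (Space d) - 1) • g y =
      (Set.Iio ρ).indicator (fun r => (2 * Real.pi) ^ (-γ) * r ^ ((d : ℝ) - 1 - γ)) y := by
    intro y hy
    have hy : 0 < y := hy
    by_cases h : y < ρ
    · simp only [g, Set.indicator_of_mem (Set.mem_Iio.2 h), finrank_euclideanSpace_fin, smul_eq_mul]
      rw [Real.mul_rpow hpi.le hy.le, sub_eq_add_neg ((d : ℝ) - 1), Real.rpow_add hy,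
        ← Real.rpow_natCast, Nat.cast_sub hd]
      push_cast
      ring
    · simp [g, h]
  have hpow : IntegrableOn (fun r : ℝ => (2 * Real.pi) ^ (-γ) * r ^ ((d : ℝ) - 1 - γ))
      (Set.Ioo 0 ρ) := by
    refine Integrable.const_mul ?_ _
    exact (intervalIntegral.integrableOn_Ioo_rpow_iff hρ0).2 (by linarith)
  have hI : Integrable (fun ξ : Space d => g ‖ξ‖) volume := by
    rw [integrable_fun_norm_addHaar, integrableOn_congr_fun hint measurableSet_Ioi,
      IntegrableOn, integrable_indicator_iff measurableSet_Iio, IntegrableOn,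
      Measure.restrict_restrict measurableSet_Iio, Set.inter_comm, Set.Ioi_inter_Iio]
    exact hpow
  have hg0 : ∀ y, 0 ≤ y → 0 ≤ g y := fun y hy =>
    Set.indicator_apply_nonneg fun _ => by positivity
  rw [← lintegral_indicator hmeas]
  have h1 : ∀ ξ : Space d, {ξ : Space d | ‖(2 * Real.pi) • ξ‖ < R}.indicator
      (fun ξ => ENNReal.ofReal (‖(2 * Real.pi) • ξ‖ ^ (-γ))) ξ = ENNReal.ofReal (g ‖ξ‖) := by
    intro ξ
    by_cases h : ‖ξ‖ < ρ
    · rw [Set.indicator_of_mem (s := {ξ : Space d | ‖(2 * Real.pi) • ξ‖ < R}) ((hS ξ).2 h)]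
      simp only [g, Set.indicator_of_mem (Set.mem_Iio.2 h), hnorm]
    · rw [Set.indicator_of_notMem (s := {ξ : Space d | ‖(2 * Real.pi) • ξ‖ < R})
        (fun h' => h ((hS ξ).1 h'))]
      simp [g, h]
  simp only [h1]
  rw [← ofReal_integral_eq_lintegral_ofReal hI (.of_forall fun ξ => hg0 _ (norm_nonneg _)),
    integral_fun_norm_addHaar, setIntegral_congr_fun measurableSet_Ioi hint,
    setIntegral_indicator measurableSet_Iio, Set.Ioi_inter_Iio, integral_const_mul,
    ← integral_Ioc_eq_integral_Ioo, ← intervalIntegral.integral_of_le hρ0.le,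
    integral_rpow (Or.inl (by linarith))]
  congr 1
  have e1 : (d : ℝ) - 1 - γ + 1 = d - γ := by ring
  rw [e1, Real.zero_rpow (by linarith), hρ, Real.div_rpow hR.le hpi.le, sub_zero,
    Real.rpow_sub hpi, Real.rpow_natCast, Real.rpow_neg hpi.le, finrank_euclideanSpace_fin]
  have : (d : ℝ) - γ ≠ 0 := by linarith
  simp only [nsmul_eq_mul, smul_eq_mul]
  field_simp

/-! ### High and low frequencies -/

lemma measurableSet_mul_lt {G : Space d → ℝ} (hG : Measurable G) (a c : ℝ) :
    MeasurableSet {ξ | a * G ξ < c} :=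
  measurableSet_lt (hG.const_mul a) measurable_const

/-- The frequencies where the symbol `G` is large contribute a bounded operator: this is the
dyadic form of a maximal inequality for Fourier multipliers. -/
lemma tsum_lintegral_cutoff_compl_le {G : Space d → ℝ} (hG : Measurable G) (hG0 : ∀ ξ, 0 ≤ G ξ)
    {u e : L2 d} (h : e =ᵐ[volume] fun ξ => (G ξ : ℂ) * u ξ) {a : ℝ} (ha : 0 < a) :
    ∑' k : ℤ, ENNReal.ofReal (4 ^ k) * ∫⁻ x, ‖(Lp.fourierTransformₗᵢ (Space d) ℂ).symm
        (cutoff {ξ | a * G ξ < 2 ^ k}ᶜ (measurableSet_mul_lt hG a _).compl u) x‖ₑ ^ 2 ≤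
      ENNReal.ofReal (4 * a ^ 2) * ‖e‖ₑ ^ 2 := by
  have hS : ∀ k : ℤ, MeasurableSet {ξ | a * G ξ < 2 ^ k}ᶜ := fun k =>
    (measurableSet_mul_lt hG a _).compl
  have hu : AEMeasurable (fun ξ => ‖u ξ‖ₑ ^ 2) volume :=
    ((Lp.aestronglyMeasurable u).enorm).pow_const 2
  have h1 : ∀ k : ℤ, ENNReal.ofReal (4 ^ k) * ∫⁻ x, ‖(Lp.fourierTransformₗᵢ (Space d) ℂ).symm
        (cutoff {ξ | a * G ξ < 2 ^ k}ᶜ (hS k) u) x‖ₑ ^ 2 =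
      ∫⁻ ξ, (if (2 : ℝ) ^ k ≤ a * G ξ then ENNReal.ofReal (4 ^ k) else 0) * ‖u ξ‖ₑ ^ 2 := by
    intro k
    -- Plancherel: only the size of the cut-off function on the Fourier side matters.
    rw [lintegral_enorm_sq, LinearIsometryEquiv.enorm_map, ← lintegral_enorm_sq,
      ← lintegral_const_mul' _ _ ENNReal.ofReal_ne_top]
    refine lintegral_congr_ae ?_
    filter_upwards [coeFn_cutoff _ (hS k) u] with ξ hξ
    rw [hξ]
    by_cases hk : (2 : ℝ) ^ k ≤ a * G ξ
    · rw [if_pos hk, Set.indicator_of_mem (by simpa using hk)]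
    · rw [if_neg hk, Set.indicator_of_notMem (by simpa using hk)]
      simp
  calc _ = ∑' k : ℤ, ∫⁻ ξ,
        (if (2 : ℝ) ^ k ≤ a * G ξ then ENNReal.ofReal (4 ^ k) else 0) * ‖u ξ‖ₑ ^ 2 :=
        tsum_congr h1
    _ = ∫⁻ ξ, ∑' k : ℤ,
        (if (2 : ℝ) ^ k ≤ a * G ξ then ENNReal.ofReal (4 ^ k) else 0) * ‖u ξ‖ₑ ^ 2 := by
        refine (lintegral_tsum fun k => AEMeasurable.mul ?_ hu).symm
        exact (Measurable.ite (measurableSet_le measurable_const (hG.const_mul a))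
          measurable_const measurable_const).aemeasurable
    _ ≤ ∫⁻ ξ, ENNReal.ofReal (4 * a ^ 2) * ‖e ξ‖ₑ ^ 2 := by
        refine lintegral_mono_ae ?_
        filter_upwards [h] with ξ hξ
        rw [ENNReal.tsum_mul_right, hξ, enorm_mul, mul_pow, ← mul_assoc]
        gcongr
        refine (tsum_four_zpow_le _ (mul_nonneg ha.le (hG0 ξ))).trans (le_of_eq ?_)
        rw [← ofReal_norm, ← ENNReal.ofReal_pow (norm_nonneg _),
          ← ENNReal.ofReal_mul (by positivity), Complex.norm_real, Real.norm_eq_abs, sq_abs]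
        congr 1
        ring
    _ = _ := by
        rw [lintegral_const_mul' _ _ ENNReal.ofReal_ne_top, lintegral_enorm_sq]

/-- The frequencies where the symbol `G` is small contribute a Hilbert–Schmidt operator. -/
lemma ae_sum_enorm_cutoff_le {ι : Type*} [Fintype ι] {G : Space d → ℝ} (hG : Measurable G)
    (hG0 : ∀ᵐ ξ : Space d, G ξ ≠ 0) {u e : ι → L2 d} (he : Orthonormal ℂ e)
    (h : ∀ i, e i =ᵐ[volume] fun ξ => (G ξ : ℂ) * u i ξ) {S : Set (Space d)}
    (hS : MeasurableSet S) (hfin : ∫⁻ ξ in S, ENNReal.ofReal ((G ξ ^ 2)⁻¹) ≠ ∞) :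
    ∀ᵐ x, ∑ i, ‖(Lp.fourierTransformₗᵢ (Space d) ℂ).symm (cutoff S hS (u i)) x‖ₑ ^ 2 ≤
      ∫⁻ ξ in S, ENNReal.ofReal ((G ξ ^ 2)⁻¹) := by
  -- Since `e i = G * u i`, the cutoff of `u i` is `q * e i` with `q` in `L²`. It is thus
  -- integrable, and its inverse transform is a genuine integral.
  let q : Space d → ℂ := S.indicator fun ξ => ((G ξ)⁻¹ : ℂ)
  have hqm : Measurable q := (Complex.measurable_ofReal.comp hG).inv.indicator hS
  have hq2 : ∫⁻ ξ, ‖q ξ‖ₑ ^ 2 = ∫⁻ ξ in S, ENNReal.ofReal ((G ξ ^ 2)⁻¹) := by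
    rw [← lintegral_indicator hS]
    refine lintegral_congr fun ξ => ?_
    by_cases hξ : ξ ∈ S
    · simp only [q, Set.indicator_of_mem hξ]
      rw [← ofReal_norm, ← ENNReal.ofReal_pow (norm_nonneg _), norm_inv, Complex.norm_real,
        Real.norm_eq_abs, inv_pow, sq_abs]
    · simp [q, Set.indicator_of_notMem hξ]
  have hq : MemLp q 2 volume := by
    refine ⟨hqm.aestronglyMeasurable, ?_⟩
    rw [eLpNorm_lt_top_iff_lintegral_rpow_enorm_lt_top (by norm_num) (by norm_num)]
    simp only [ENNReal.toReal_ofNat, ENNReal.rpow_ofNat]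
    rw [hq2]
    exact hfin.lt_top
  have hcut : ∀ i, cutoff S hS (u i) =ᵐ[volume] fun ξ => q ξ * e i ξ := by
    intro i
    filter_upwards [coeFn_cutoff S hS (u i), h i, hG0] with ξ h1 h2 h3
    rw [h1, h2]
    by_cases hξ : ξ ∈ S
    · simp only [q, Set.indicator_of_mem hξ]
      rw [inv_mul_cancel_left₀ (by exact_mod_cast h3)]
    · simp [q, Set.indicator_of_notMem hξ]
  have hint : ∀ i, Integrable (cutoff S hS (u i)) volume := fun i =>
    (hq.integrable_mul (Lp.memLp (e i))).congr (hcut i).symm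
  have hae := ae_all_iff.2 fun i => coeFn_fourierTransform_symm _ (hint i)
  filter_upwards [hae] with x hx
  -- At fixed `x`, the values for all `i` are pairings of the `e i` with this single function, whose
  -- modulus `|q|` does not depend on `x`.
  let k : Space d → ℂ := fun ξ => (Real.fourierChar ⟪ξ, x⟫_ℝ : ℂ) * q ξ
  have hchar : Continuous fun ξ : Space d => (Real.fourierChar ⟪ξ, x⟫_ℝ : ℂ) :=
    continuous_subtype_val.comp (Real.continuous_fourierChar.comp (by fun_prop))
  have hkn : ∀ ξ, ‖k ξ‖ₑ = ‖q ξ‖ₑ := fun ξ => by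
    rw [enorm_mul, ← ofReal_norm, Circle.norm_coe, ENNReal.ofReal_one, one_mul]
  have hk : MemLp k 2 volume :=
    hq.congr_norm (hchar.aestronglyMeasurable.mul hqm.aestronglyMeasurable)
      (.of_forall fun ξ => by rw [norm_mul, Circle.norm_coe, one_mul])
  rw [← hq2]
  simp only [← hkn]
  refine le_trans (le_of_eq ?_) (sum_enorm_integral_mul_sq_le he hk)
  refine Finset.sum_congr rfl fun i _ => ?_
  rw [hx i, Real.fourierInv_eq]
  congr 2
  refine integral_congr_ae ?_
  filter_upwards [hcut i] with ξ hξ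
  rw [hξ, Circle.smul_def, smul_eq_mul, mul_assoc]

/-! ### Dyadic decomposition and the abstract counting bound -/

lemma setLIntegral_mono_of_nullMeasurableSet {s : Set (Space d)}
    (hs : NullMeasurableSet s volume) {f g : Space d → ℝ≥0∞} (h : ∀ x ∈ s, f x ≤ g x) :
    ∫⁻ x in s, f x ≤ ∫⁻ x in s, g x :=
  lintegral_mono_ae ((ae_restrict_mem₀ hs).mono h)

/-- Weighted Cauchy–Schwarz: the right side minus `(‖z‖ + ‖w‖)²` is a perfect square over `μ (1 -
μ)`. This replaces the triangle inequality in `L²` while keeping its sharp constant. -/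
lemma enorm_add_sq_le (z w : ℂ) {μ : ℝ} (hμ0 : 0 < μ) (hμ1 : μ < 1) :
    ‖z + w‖ₑ ^ 2 ≤ ENNReal.ofReal (1 - μ)⁻¹ * ‖z‖ₑ ^ 2 + ENNReal.ofReal μ⁻¹ * ‖w‖ₑ ^ 2 := by
  have h1 : 0 < 1 - μ := by linarith
  simp only [← ofReal_norm, ← ENNReal.ofReal_pow (norm_nonneg _)]
  rw [← ENNReal.ofReal_mul (by positivity), ← ENNReal.ofReal_mul (by positivity),
    ← ENNReal.ofReal_add (by positivity) (by positivity)]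
  refine ENNReal.ofReal_le_ofReal ?_
  have h2 : ‖z + w‖ ^ 2 ≤ (‖z‖ + ‖w‖) ^ 2 := by gcongr; exact norm_add_le z w
  refine h2.trans ?_
  have h3 : (1 - μ)⁻¹ * ‖z‖ ^ 2 + μ⁻¹ * ‖w‖ ^ 2 - (‖z‖ + ‖w‖) ^ 2 =
      (μ * ‖z‖ - (1 - μ) * ‖w‖) ^ 2 / (μ * (1 - μ)) := by
    field_simp
    ring
  have h4 : 0 ≤ (μ * ‖z‖ - (1 - μ) * ‖w‖) ^ 2 / (μ * (1 - μ)) := by positivity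
  linarith

/-- The set where `f` takes values in the dyadic interval `(2 ^ (k - 1), 2 ^ k]`. -/
def dyadicLevel (f : Space d → ℝ) (k : ℤ) : Set (Space d) :=
  {x | 2 ^ (k - 1) < f x ∧ f x ≤ 2 ^ k}

lemma exists_mem_dyadicLevel {f : Space d → ℝ} {x : Space d} (hx : 0 < f x) :
    ∃ k, x ∈ dyadicLevel f k := by
  refine ⟨Int.clog 2 (f x), ?_, ?_⟩
  · exact_mod_cast Int.zpow_pred_clog_lt_self (b := 2) (by norm_num) hx
  · exact_mod_cast Int.self_le_zpow_clog (b := 2) (by norm_num) (f x)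

lemma nullMeasurableSet_dyadicLevel {f : Space d → ℝ} (hf : AEMeasurable f volume) (k : ℤ) :
    NullMeasurableSet (dyadicLevel f k) volume :=
  (nullMeasurableSet_lt aemeasurable_const hf).inter (nullMeasurableSet_le hf aemeasurable_const)

lemma pairwise_disjoint_dyadicLevel (f : Space d → ℝ) :
    Pairwise (Function.onFun Disjoint (dyadicLevel f)) := by
  have key : ∀ k l : ℤ, k < l → Disjoint (dyadicLevel f k) (dyadicLevel f l) := by
    intro k l hkl
    refine Set.disjoint_left.2 fun x hx hy => ?_
    have h1 : (2 : ℝ) ^ k ≤ 2 ^ (l - 1) := zpow_le_zpow_right₀ (by norm_num) (by omega)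
    linarith [hx.2, hy.1]
  intro k l hkl
  rcases lt_or_gt_of_ne hkl with h | h
  · exact key k l h
  · exact (key l k h).symm

/-- The dyadic decomposition bound for the number of functions `e i`, orthonormal in `L²`, on which
multiplication by `f` after the Fourier multiplier `1 / G` does not decrease the norm. -/
lemma card_le_tsum_dyadic {ι : Type*} [Fintype ι] {G : Space d → ℝ} (hG : Measurable G)
    (hG0 : ∀ ξ, 0 ≤ G ξ) (hG1 : ∀ᵐ ξ : Space d, G ξ ≠ 0) {u e : ι → L2 d} (he : Orthonormal ℂ e)
    (h : ∀ i, e i =ᵐ[volume] fun ξ => (G ξ : ℂ) * u i ξ) {f : Space d → ℝ}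
    (hf : AEMeasurable f volume) (hf0 : ∀ x, 0 ≤ f x)
    (hfu : ∀ i, 1 ≤ ∫⁻ x, ENNReal.ofReal (f x ^ 2) *
      ‖(Lp.fourierTransformₗᵢ (Space d) ℂ).symm (u i) x‖ₑ ^ 2)
    {a : ℝ} (ha : 0 < a) (ha1 : 2 * a < 1)
    (hfin : ∀ k : ℤ, ∫⁻ ξ in {ξ | a * G ξ < 2 ^ k}, ENNReal.ofReal ((G ξ ^ 2)⁻¹) ≠ ∞) :
    (Fintype.card ι : ℝ≥0∞) ≤ ENNReal.ofReal (((1 - 2 * a) ^ 2)⁻¹) *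
      ∑' k : ℤ, ∫⁻ x in dyadicLevel f k, ENNReal.ofReal (f x ^ 2) *
        ∫⁻ ξ in {ξ | a * G ξ < 2 ^ k}, ENNReal.ofReal ((G ξ ^ 2)⁻¹) := by
  have hμ0 : 0 < 2 * a := by linarith
  have hμ1 : 0 < 1 - 2 * a := by linarith
  let F := (Lp.fourierTransformₗᵢ (Space d) ℂ).symm
  let S : ℤ → Set (Space d) := fun k => {ξ | a * G ξ < 2 ^ k}
  have hS : ∀ k, MeasurableSet (S k) := fun k => measurableSet_mul_lt hG a _
  -- `H` is the low-frequency part, to be counted, and `B` the high-frequency part, to be absorbed;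
  -- the threshold depends on the level of `f`.
  let H : ι → ℤ → L2 d := fun i k => F (cutoff (S k) (hS k) (u i))
  let B : ι → ℤ → L2 d := fun i k => F (cutoff (S k)ᶜ (hS k).compl (u i))
  have hHB : ∀ i k, F (u i) =ᵐ[volume] fun x => H i k x + B i k x := by
    intro i k
    have : F (u i) = H i k + B i k := by
      rw [← map_add, cutoff_add_cutoff_compl]
    rw [this]
    exact Lp.coeFn_add _ _
  have hf2 : AEMeasurable (fun x => ENNReal.ofReal (f x ^ 2)) volume :=
    (hf.pow_const 2).ennreal_ofReal
  have hm : ∀ v : L2 d, AEMeasurable (fun x => ‖v x‖ₑ ^ 2) volume := fun v =>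
    ((Lp.aestronglyMeasurable v).enorm).pow_const 2
  let P : ι → ℝ≥0∞ := fun i => ∑' k : ℤ, ∫⁻ x in dyadicLevel f k,
    ENNReal.ofReal (f x ^ 2) * ‖H i k x‖ₑ ^ 2
  let Q : ι → ℝ≥0∞ := fun i => ∑' k : ℤ, ∫⁻ x in dyadicLevel f k,
    ENNReal.ofReal (f x ^ 2) * ‖B i k x‖ₑ ^ 2
  have hQ : ∀ i, Q i ≤ ENNReal.ofReal ((2 * a) ^ 2) := by
    intro i
    have := tsum_lintegral_cutoff_compl_le hG hG0 (h i) ha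
    have hn : ‖e i‖ₑ = 1 := by rw [← ofReal_norm, he.1 i, ENNReal.ofReal_one]
    rw [hn, one_pow, mul_one] at this
    rw [show (2 * a) ^ 2 = 4 * a ^ 2 by ring]
    refine le_trans (ENNReal.tsum_le_tsum fun k => ?_) this
    rw [← lintegral_const_mul' _ _ ENNReal.ofReal_ne_top]
    refine le_trans (setLIntegral_mono_of_nullMeasurableSet (nullMeasurableSet_dyadicLevel hf k)
      fun x hx => ?_) (setLIntegral_le_lintegral _ _)
    refine mul_le_mul' (ENNReal.ofReal_le_ofReal ?_) le_rfl
    calc f x ^ 2 ≤ (2 ^ k) ^ 2 := by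
          have := hf0 x
          gcongr
          exact hx.2
      _ = 4 ^ k := by
          rw [← zpow_natCast, zpow_comm]
          norm_num
  have hsplit : ∀ i, (1 : ℝ≥0∞) ≤
      ENNReal.ofReal (1 - 2 * a)⁻¹ * P i + ENNReal.ofReal (2 * a)⁻¹ * Q i := by
    intro i
    refine (hfu i).trans ?_
    calc _ ≤ ∫⁻ x in ⋃ k, dyadicLevel f k, ENNReal.ofReal (f x ^ 2) * ‖F (u i) x‖ₑ ^ 2 := by
          -- Points outside all dyadic levels have `f x = 0` and contribute nothing.
          rw [← lintegral_indicator₀ (.iUnion fun k => nullMeasurableSet_dyadicLevel hf k)]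
          refine lintegral_mono fun x => ?_
          rcases (hf0 x).eq_or_lt with h0 | h0
          · simp [← h0]
          · rw [Set.indicator_of_mem (Set.mem_iUnion.2 (exists_mem_dyadicLevel h0))]
      _ ≤ ∑' k, ∫⁻ x in dyadicLevel f k, ENNReal.ofReal (f x ^ 2) * ‖F (u i) x‖ₑ ^ 2 :=
          lintegral_iUnion_le _ _
      _ ≤ ∑' k, (ENNReal.ofReal (1 - 2 * a)⁻¹ * (∫⁻ x in dyadicLevel f k,
            ENNReal.ofReal (f x ^ 2) * ‖H i k x‖ₑ ^ 2) +
          ENNReal.ofReal (2 * a)⁻¹ * ∫⁻ x in dyadicLevel f k,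
            ENNReal.ofReal (f x ^ 2) * ‖B i k x‖ₑ ^ 2) := by
          refine ENNReal.tsum_le_tsum fun k => ?_
          rw [← lintegral_const_mul' _ _ ENNReal.ofReal_ne_top,
            ← lintegral_const_mul' _ _ ENNReal.ofReal_ne_top, ← lintegral_add_left']
          · refine lintegral_mono_ae (ae_restrict_of_ae ?_)
            filter_upwards [hHB i k] with x hx
            rw [hx]
            refine (mul_le_mul' le_rfl (enorm_add_sq_le _ _ hμ0 ha1)).trans (le_of_eq ?_)
            ring
          · exact ((hf2.mul (hm _)).const_mul _).restrict
      _ = _ := by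
          rw [ENNReal.tsum_add, ENNReal.tsum_mul_left, ENNReal.tsum_mul_left]
  -- With weight `μ = 2 * a` the high part costs at most `(2 * a)² / (2 * a) = 2 * a`, which is
  -- subtracted from `1`.
  have hP : ∀ i, (1 : ℝ≥0∞) ≤ ENNReal.ofReal (((1 - 2 * a) ^ 2)⁻¹) * P i := by
    intro i
    have h1 : (1 : ℝ≥0∞) ≤ ENNReal.ofReal (1 - 2 * a)⁻¹ * P i + ENNReal.ofReal (2 * a) := by
      refine (hsplit i).trans (add_le_add le_rfl ?_)
      refine (mul_le_mul' le_rfl (hQ i)).trans (le_of_eq ?_)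
      rw [← ENNReal.ofReal_mul (by positivity)]
      congr 1
      field_simp
    have h2 : ENNReal.ofReal (1 - 2 * a) ≤ ENNReal.ofReal (1 - 2 * a)⁻¹ * P i := by
      rw [ENNReal.ofReal_sub _ hμ0.le, ENNReal.ofReal_one]
      exact tsub_le_iff_right.2 h1
    calc (1 : ℝ≥0∞) = ENNReal.ofReal (1 - 2 * a)⁻¹ * ENNReal.ofReal (1 - 2 * a) := by
          rw [← ENNReal.ofReal_mul (by positivity), inv_mul_cancel₀ hμ1.ne', ENNReal.ofReal_one]
      _ ≤ ENNReal.ofReal (1 - 2 * a)⁻¹ * (ENNReal.ofReal (1 - 2 * a)⁻¹ * P i) :=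
          mul_le_mul' le_rfl h2
      _ = _ := by
          rw [← mul_assoc, ← ENNReal.ofReal_mul (by positivity), ← mul_inv, sq]
  calc (Fintype.card ι : ℝ≥0∞) = ∑ _i : ι, 1 := by simp
    _ ≤ ∑ i, ENNReal.ofReal (((1 - 2 * a) ^ 2)⁻¹) * P i := Finset.sum_le_sum fun i _ => hP i
    _ = ENNReal.ofReal (((1 - 2 * a) ^ 2)⁻¹) * ∑' k : ℤ, ∑ i, ∫⁻ x in dyadicLevel f k,
          ENNReal.ofReal (f x ^ 2) * ‖H i k x‖ₑ ^ 2 := by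
        rw [← Finset.mul_sum, Summable.tsum_finsetSum fun _ _ => ENNReal.summable]
    _ ≤ _ := by
        refine mul_le_mul' le_rfl (ENNReal.tsum_le_tsum fun k => ?_)
        rw [← lintegral_finsetSum' _ fun i _ => AEMeasurable.restrict (f := fun x =>
          ENNReal.ofReal (f x ^ 2) * ‖H i k x‖ₑ ^ 2) (hf2.mul (hm _))]
        refine lintegral_mono_ae (ae_restrict_of_ae ?_)
        filter_upwards [ae_sum_enorm_cutoff_le hG hG1 he h (hS k) (hfin k)] with x hx
        rw [← Finset.mul_sum]
        exact mul_le_mul' le_rfl hx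

/-! ### The symbol `|p|^(γ/2)` and the constant -/

/-- The bound of Cwikel type for the symbol `|p|^(γ/2)`. -/
lemma card_le_lintegral_rpow {ι : Type*} [Fintype ι] {γ : ℝ} (hγ : 0 < γ) (hγd : γ < d)
    {u e : ι → L2 d} (he : Orthonormal ℂ e)
    (h : ∀ i, e i =ᵐ[volume] fun ξ => ((√(‖(2 * Real.pi) • ξ‖ ^ γ) : ℝ) : ℂ) * u i ξ)
    {f : Space d → ℝ} (hf : AEMeasurable f volume) (hf0 : ∀ x, 0 ≤ f x)
    (hfu : ∀ i, 1 ≤ ∫⁻ x, ENNReal.ofReal (f x ^ 2) *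
      ‖(Lp.fourierTransformₗᵢ (Space d) ℂ).symm (u i) x‖ₑ ^ 2) :
    (Fintype.card ι : ℝ≥0∞) ≤ ENNReal.ofReal
        ((4 * (d : ℝ) / ((d : ℝ) - γ)) ^ (2 * (d : ℝ) / γ) *
          ((d : ℝ) * ((d : ℝ) - γ) / (4 * γ) ^ 2) *
          (volume.real (Metric.ball (0 : Space d) 1) / (2 * Real.pi) ^ d)) *
        ∫⁻ x : Space d, ENNReal.ofReal (f x ^ (2 * (d : ℝ) / γ)) := by
  have hd0 : (0 : ℝ) < d := hγ.trans hγd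
  have hd : 0 < d := by exact_mod_cast hd0
  have : Nonempty (Fin d) := ⟨⟨0, hd⟩⟩
  have hdγ : 0 < (d : ℝ) - γ := by linarith
  have hpi : 0 < 2 * Real.pi := by positivity
  -- This `a` minimises `(1 - 2a)⁻² (2/a)^(2d/γ - 2)`, the `a`-dependent factor of the final
  -- constant.
  set a : ℝ := (d - γ) / (2 * d) with ha_def
  have ha : 0 < a := by positivity
  have ha' : 1 - 2 * a = γ / d := by rw [ha_def]; field_simp; ring
  have ha1 : 2 * a < 1 := by
    have : 0 < γ / d := by positivity
    linarith
  set ω : ℝ := volume.real (Metric.ball (0 : Space d) 1) / (2 * Real.pi) ^ d with hω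
  have hω0 : 0 ≤ ω := by positivity
  let G : Space d → ℝ := fun ξ => √(‖(2 * Real.pi) • ξ‖ ^ γ)
  have hG : Measurable G := by fun_prop
  have hG1 : ∀ᵐ ξ : Space d, G ξ ≠ 0 := by
    filter_upwards [Measure.ae_ne volume (0 : Space d)] with ξ hξ
    have h1 : 0 < ‖(2 * Real.pi) • ξ‖ := norm_pos_iff.2 (smul_ne_zero hpi.ne' hξ)
    exact (Real.sqrt_pos.2 (Real.rpow_pos_of_pos h1 _)).ne'
  have hball : ∀ c : ℝ, 0 < c → ∫⁻ ξ in {ξ | a * G ξ < c}, ENNReal.ofReal ((G ξ ^ 2)⁻¹) =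
      ENNReal.ofReal ((d : ℝ) / (d - γ) * ω * ((c / a) ^ (2 / γ)) ^ (d - γ)) := by
    intro c hc
    rw [hω, ← lintegral_norm_rpow_neg_ball γ hγd hd (by positivity)]
    have hset : {ξ | a * G ξ < c} = {ξ : Space d | ‖(2 * Real.pi) • ξ‖ < (c / a) ^ (2 / γ)} := by
      ext ξ
      simp only [Set.mem_ofPred_eq, G]
      rw [← lt_div_iff₀' ha, Real.sqrt_lt' (by positivity),
        Real.lt_rpow_inv_iff_of_pos (norm_nonneg _) (by positivity) hγ |>.symm, ← Real.rpow_natCast,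
        ← Real.rpow_mul (by positivity)]
      norm_num [div_eq_mul_inv]
    rw [hset]
    refine lintegral_congr fun ξ => ?_
    rw [Real.sq_sqrt (by positivity), Real.rpow_neg (norm_nonneg _)]
  refine (card_le_tsum_dyadic hG (fun ξ => Real.sqrt_nonneg _) hG1 he h hf hf0 hfu ha ha1
    fun k => by rw [hball _ (by positivity)]; exact ENNReal.ofReal_ne_top).trans ?_
  set p : ℝ := 2 * d / γ with hp
  have hexp : ∀ t : ℝ, 0 < t → (t ^ (2 / γ)) ^ ((d : ℝ) - γ) = t ^ (p - 2) := by
    intro t ht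
    rw [← Real.rpow_mul ht.le]
    congr 1
    rw [hp]
    field_simp
  have hp2 : 0 ≤ p - 2 := by
    rw [hp, sub_nonneg, le_div_iff₀ hγ]
    linarith
  have hpoint : ∀ k : ℤ, ∀ x ∈ dyadicLevel f k, ENNReal.ofReal (f x ^ 2) *
      ENNReal.ofReal ((d : ℝ) / (d - γ) * ω * (((2 : ℝ) ^ k / a) ^ (2 / γ)) ^ ((d : ℝ) - γ)) ≤
      ENNReal.ofReal ((d : ℝ) / (d - γ) * ω * (2 / a) ^ (p - 2)) *
        ENNReal.ofReal (f x ^ p) := by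
    intro k x hx
    have hfx : 0 < f x := lt_trans (by positivity) hx.1
    rw [← ENNReal.ofReal_mul (by positivity), ← ENNReal.ofReal_mul (by positivity)]
    refine ENNReal.ofReal_le_ofReal ?_
    -- The lower edge of the dyadic level gives `2 ^ k < 2 * f x`; the decomposition loses only this
    -- factor `2`.
    have h2k : (2 : ℝ) ^ k / a ≤ 2 / a * f x := by
      have h1 := hx.1
      rw [zpow_sub_one₀ (by norm_num)] at h1
      rw [div_mul_eq_mul_div]
      gcongr
      linarith
    rw [hexp _ (by positivity)]
    calc _ ≤ f x ^ 2 * ((d : ℝ) / (d - γ) * ω * (2 / a * f x) ^ (p - 2)) := by gcongr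
      _ = _ := by
          rw [Real.mul_rpow (by positivity) hfx.le]
          have : f x ^ p = f x ^ 2 * f x ^ (p - 2) := by
            rw [← Real.rpow_natCast, ← Real.rpow_add hfx]
            norm_num
          rw [this]
          ring
  calc _ ≤ ENNReal.ofReal (((1 - 2 * a) ^ 2)⁻¹) * ∑' k : ℤ, ∫⁻ x in dyadicLevel f k,
        ENNReal.ofReal ((d : ℝ) / (d - γ) * ω * (2 / a) ^ (p - 2)) *
          ENNReal.ofReal (f x ^ p) := by
        refine mul_le_mul' le_rfl (ENNReal.tsum_le_tsum fun k => ?_)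
        refine setLIntegral_mono_of_nullMeasurableSet (nullMeasurableSet_dyadicLevel hf k)
          fun x hx => ?_
        rw [hball _ (by positivity)]
        exact hpoint k x hx
    _ ≤ ENNReal.ofReal (((1 - 2 * a) ^ 2)⁻¹) * ∫⁻ x,
        ENNReal.ofReal ((d : ℝ) / (d - γ) * ω * (2 / a) ^ (p - 2)) *
          ENNReal.ofReal (f x ^ p) := by
        rw [← lintegral_iUnion₀ (fun k => nullMeasurableSet_dyadicLevel hf k)
          ((pairwise_disjoint_dyadicLevel f).aedisjoint)]
        exact mul_le_mul' le_rfl (setLIntegral_le_lintegral _ _)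
    _ = _ := by
        rw [lintegral_const_mul' _ _ ENNReal.ofReal_ne_top, ← mul_assoc,
          ← ENNReal.ofReal_mul (by positivity)]
        congr 2
        have h2a : 2 / a = 4 * d / (d - γ) := by rw [ha_def]; field_simp; norm_num
        rw [ha', h2a, Real.rpow_sub (by positivity)]
        norm_num
        field_simp

/-! ### The quadratic form on eigenfunctions -/

lemma star_form (T V : Space d → ℝ) (φ ψ : formDomain T V) :
    star (form T V φ ψ) = form T V ψ φ := by
  simp only [form, star_sub, star_add]
  congr 1
  · congr 1
    · exact inner_conj_symm _ _
    · exact inner_conj_symm _ _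
  · exact inner_conj_symm _ _

/-- The form of `T(p) + V` as a linear map in its second argument. -/
noncomputable def formLinear (T V : Space d → ℝ) (φ : formDomain T V) :
    formDomain T V →ₗ[ℂ] ℂ where
  toFun := form T V φ
  map_add' := form_add T V φ
  map_smul' c ψ := form_smul T V c φ ψ

lemma form_self (T V : Space d → ℝ) (φ : formDomain T V) :
    form T V φ φ = ((‖sqrtKinetic T ⟨φ, φ.2.1⟩‖ ^ 2 + ‖sqrtPos V ⟨φ, φ.2.2.1⟩‖ ^ 2 -
      ‖sqrtNeg V ⟨φ, φ.2.2.2⟩‖ ^ 2 : ℝ) : ℂ) := by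
  simp only [form, inner_self_eq_norm_sq_to_K]
  push_cast
  rfl

lemma mem_formDomain_of_mem_eigenspace {T V : Space d → ℝ} {E : ℝ} {ψ : L2 d}
    (hψ : ψ ∈ eigenspace T V E) : ψ ∈ formDomain T V :=
  hψ.1

lemma form_of_mem_eigenspace {T V : Space d → ℝ} {E : ℝ} {ψ : L2 d}
    (hψ : ψ ∈ eigenspace T V E) (φ : formDomain T V) :
    form T V φ ⟨ψ, mem_formDomain_of_mem_eigenspace hψ⟩ = E * ⟪(φ : L2 d), ψ⟫_ℂ := by
  have h := hψ.2 φ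
  rw [← inner_smul_right]
  exact h

/-- Evaluating the Hermitian form on the two eigenfunctions in both orders gives `(E' - E) ⟪ψ, φ⟫ =
0`. -/
lemma inner_eq_zero_of_mem_eigenspace {T V : Space d → ℝ} {E E' : ℝ} (hE : E ≠ E') {φ ψ : L2 d}
    (hφ : φ ∈ eigenspace T V E) (hψ : ψ ∈ eigenspace T V E') : ⟪φ, ψ⟫_ℂ = 0 := by
  have h1 := form_of_mem_eigenspace hψ ⟨φ, mem_formDomain_of_mem_eigenspace hφ⟩
  have h2 := form_of_mem_eigenspace hφ ⟨ψ, mem_formDomain_of_mem_eigenspace hψ⟩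
  rw [← star_form, h1] at h2
  have h3 : star ⟪φ, ψ⟫_ℂ = ⟪ψ, φ⟫_ℂ := inner_conj_symm _ _
  have h4 : (E' : ℂ) * ⟪ψ, φ⟫_ℂ = E * ⟪ψ, φ⟫_ℂ := by
    rw [← h2, star_mul', ← h3]
    simp
  have h5 : ((E' : ℂ) - E) * ⟪ψ, φ⟫_ℂ = 0 := by rw [sub_mul, h4, sub_self]
  have h6 : (E' : ℂ) - E ≠ 0 := sub_ne_zero.2 (by exact_mod_cast hE.symm)
  exact inner_eq_zero_symm.1 ((mul_eq_zero.1 h5).resolve_left h6)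

/-- The form of `T(p) + V` is negative on the span of eigenfunctions with negative eigenvalues. -/
lemma norm_sqrtKinetic_lt_norm_sqrtNeg {T V : Space d → ℝ} {J : Type*} [Fintype J] {E : J → ℝ}
    (hE : ∀ j, E j < 0) {φ : J → L2 d} (hφ : Orthonormal ℂ φ)
    (hφE : ∀ j, φ j ∈ eigenspace T V (E j)) {w : formDomain T V} (hw0 : w ≠ 0)
    (hw : w ∈ Submodule.span ℂ (Set.range fun j =>
      (⟨φ j, mem_formDomain_of_mem_eigenspace (hφE j)⟩ : formDomain T V))) :
    ‖sqrtKinetic T ⟨w, w.2.1⟩‖ < ‖sqrtNeg V ⟨w, w.2.2.2⟩‖ := by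
  obtain ⟨c, hc⟩ := (Submodule.mem_span_range_iff_exists_fun ℂ).1 hw
  have hcw : (w : L2 d) = ∑ j, c j • φ j := by
    rw [← hc]
    simp
  have hin : ∀ j, ⟪(w : L2 d), φ j⟫_ℂ = star (c j) := fun j => by
    rw [hcw, hφ.inner_left_fintype]
    rfl
  -- Pairing `w` with `φ j` yields `E j * star (c j)`, so orthonormality makes the form diagonal.
  have hform : form T V w w = ((∑ j, E j * ‖c j‖ ^ 2 : ℝ) : ℂ) := by
    calc form T V w w = formLinear T V w (∑ j, c j •
          (⟨φ j, mem_formDomain_of_mem_eigenspace (hφE j)⟩ : formDomain T V)) := by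
          rw [hc]
          rfl
      _ = ∑ j, c j * form T V w ⟨φ j, mem_formDomain_of_mem_eigenspace (hφE j)⟩ := by
          rw [map_sum]
          exact Finset.sum_congr rfl fun j _ => map_smul (formLinear T V w) _ _
      _ = _ := by
          push_cast
          refine Finset.sum_congr rfl fun j _ => ?_
          rw [form_of_mem_eigenspace (hφE j), hin]
          have : c j * star (c j) = (‖c j‖ : ℂ) ^ 2 := Complex.mul_conj' _
          rw [← this]
          ring
  have hex : ∃ j, c j ≠ 0 := by
    by_contra! h
    exact hw0 (by rw [← hc]; simp [h])
  obtain ⟨j₀, hj₀⟩ := hex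
  have hneg : ∑ j, E j * ‖c j‖ ^ 2 < 0 := by
    refine Finset.sum_neg' (fun j _ => ?_) ⟨j₀, Finset.mem_univ _, ?_⟩
    · exact mul_nonpos_of_nonpos_of_nonneg (hE j).le (by positivity)
    · have : 0 < ‖c j₀‖ := norm_pos_iff.2 hj₀
      exact mul_neg_of_neg_of_pos (hE j₀) (by positivity)
  rw [form_self] at hform
  have hre := Complex.ofReal_injective hform
  refine lt_of_pow_lt_pow_left₀ 2 (norm_nonneg _) ?_
  -- The `V₊` term is nonnegative and is dropped.
  nlinarith [sq_nonneg ‖sqrtPos V ⟨w, w.2.2.1⟩‖]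

lemma coeFn_mulOp (m : Space d → ℝ) (φ : (mulOp m).domain) :
    mulOp m φ =ᵐ[volume] fun x => (m x : ℂ) * (φ : L2 d) x :=
  MemLp.coeFn_toLp φ.2

lemma coeFn_fourier_sqrtKinetic (T : Space d → ℝ) (φ : (sqrtKinetic T).domain) :
    Lp.fourierTransformₗᵢ (Space d) ℂ (sqrtKinetic T φ) =ᵐ[volume] fun ξ =>
      ((√(T ((2 * Real.pi) • ξ)) : ℝ) : ℂ) * Lp.fourierTransformₗᵢ (Space d) ℂ (φ : L2 d) ξ := by
  have h : Lp.fourierTransformₗᵢ (Space d) ℂ (sqrtKinetic T φ) =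
      mulOp (fun ξ => √(T ((2 * Real.pi) • ξ)))
        ⟨Lp.fourierTransformₗᵢ (Space d) ℂ (φ : L2 d), φ.2⟩ :=
    (Lp.fourierTransformₗᵢ (Space d) ℂ).apply_symm_apply _
  rw [h]
  exact coeFn_mulOp _ _

lemma enorm_sq_sqrtNeg (V : Space d → ℝ) (φ : (sqrtNeg V).domain) :
    ‖sqrtNeg V φ‖ₑ ^ 2 =
      ∫⁻ x, ENNReal.ofReal (√(max 0 (-V x)) ^ 2) * ‖(φ : L2 d) x‖ₑ ^ 2 := by
  rw [← lintegral_enorm_sq]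
  refine lintegral_congr_ae ?_
  filter_upwards [coeFn_mulOp (fun x => √(max 0 (-V x))) φ] with x hx
  have hx' : sqrtNeg V φ x = ((√(max 0 (-V x)) : ℝ) : ℂ) * (φ : L2 d) x := hx
  rw [hx', enorm_mul, mul_pow]
  congr 1
  rw [← ofReal_norm, ← ENNReal.ofReal_pow (norm_nonneg _), Complex.norm_real, Real.norm_eq_abs,
    sq_abs]

lemma eq_zero_of_sqrtKinetic_eq_zero {T : Space d → ℝ}
    (hT : ∀ᵐ ξ : Space d, 0 < T ((2 * Real.pi) • ξ)) {φ : (sqrtKinetic T).domain}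
    (h : sqrtKinetic T φ = 0) : φ = 0 := by
  have h1 := coeFn_fourier_sqrtKinetic T φ
  rw [h, map_zero] at h1
  have h2 : Lp.fourierTransformₗᵢ (Space d) ℂ (φ : L2 d) = 0 := by
    apply Lp.ext
    filter_upwards [h1, hT, Lp.coeFn_zero ℂ 2 (volume : Measure (Space d))] with ξ h1 h2 h3
    rw [h3] at h1 ⊢
    have : ((√(T ((2 * Real.pi) • ξ)) : ℝ) : ℂ) ≠ 0 := by exact_mod_cast (Real.sqrt_pos.2 h2).ne'
    exact (mul_eq_zero.1 h1.symm).resolve_left this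
  exact Subtype.ext ((LinearIsometryEquiv.map_eq_zero_iff _).1 h2)

/-! ### Reduction to the counting bound -/

/-- `√T(p)` as a linear map on the form domain of `T(p) + V`. -/
noncomputable def sqrtKineticForm (T V : Space d → ℝ) : formDomain T V →ₗ[ℂ] L2 d :=
  (sqrtKinetic T).toFun ∘ₗ Submodule.inclusion inf_le_left

/-- The bound on the number of orthonormal eigenfunctions with negative eigenvalues. -/
lemma card_le_of_eigenfunctions {γ : ℝ} (hγ : 0 < γ) (hγd : γ < d) {V : Space d → ℝ}
    (hV : AEMeasurable V volume) {J : Type*} [Fintype J] {E : J → ℝ} (hE : ∀ j, E j < 0)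
    {φ : J → L2 d} (hφ : Orthonormal ℂ φ)
    (hφE : ∀ j, φ j ∈ eigenspace (fun η => ‖η‖ ^ γ) V (E j)) :
    (Fintype.card J : ℝ≥0∞) ≤ ENNReal.ofReal
        ((4 * (d : ℝ) / ((d : ℝ) - γ)) ^ (2 * (d : ℝ) / γ) *
          ((d : ℝ) * ((d : ℝ) - γ) / (4 * γ) ^ 2) *
          (volume.real (Metric.ball (0 : Space d) 1) / (2 * Real.pi) ^ d)) *
        ∫⁻ x : Space d, ENNReal.ofReal (max 0 (-V x) ^ ((d : ℝ) / γ)) := by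
  let T : Space d → ℝ := fun η => ‖η‖ ^ γ
  -- In positive dimension the zero set `{0}` of the symbol is null, which makes `√T(p)` injective.
  have : Nonempty (Fin d) := ⟨⟨0, by exact_mod_cast hγ.trans hγd⟩⟩
  have hT : ∀ᵐ ξ : Space d, 0 < T ((2 * Real.pi) • ξ) := by
    filter_upwards [Measure.ae_ne volume (0 : Space d)] with ξ hξ
    have hpi : 2 * Real.pi ≠ 0 := by positivity
    exact Real.rpow_pos_of_pos (norm_pos_iff.2 (smul_ne_zero hpi hξ)) _
  let φ' : J → formDomain T V := fun j => ⟨φ j, mem_formDomain_of_mem_eigenspace (hφE j)⟩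
  have hφ' : LinearIndependent ℂ φ' :=
    LinearIndependent.of_comp (formDomain T V).subtype hφ.linearIndependent
  let W := Submodule.span ℂ (Set.range φ')
  have hWfin : FiniteDimensional ℂ W := FiniteDimensional.span_of_finite ℂ (Set.finite_range φ')
  have hW : Module.finrank ℂ W = Fintype.card J := finrank_span_eq_card hφ'
  let A := sqrtKineticForm T V
  have hA : Function.Injective A := by
    rw [injective_iff_map_eq_zero]
    intro w hw
    have := eq_zero_of_sqrtKinetic_eq_zero hT (φ := ⟨w, w.2.1⟩) hw
    exact Subtype.ext (congrArg (fun z : (sqrtKinetic T).domain => (z : L2 d)) this)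
  let L := Submodule.equivMapOfInjective A hA W
  have hW' : Module.finrank ℂ (W.map A) = Fintype.card J := by rw [← hW, L.finrank_eq]
  -- Orthonormality is needed after applying `√T(p)`, so the basis is chosen in the image and pulled
  -- back to `W`.
  let b := stdOrthonormalBasis ℂ (W.map A)
  choose w hwW hwb using fun i => (Submodule.mem_map.1 (b i).2)
  let F := Lp.fourierTransformₗᵢ (Space d) ℂ
  have hAw : Orthonormal ℂ fun i => A (w i) := by
    have := b.orthonormal.comp_linearIsometry (W.map A).subtypeₗᵢ
    convert this using 2 with i
    exact hwb i
  have he : Orthonormal ℂ fun i => F (A (w i)) := hAw.comp_linearIsometry F.toLinearIsometry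
  have hcard := card_le_lintegral_rpow hγ hγd (u := fun i => F (w i)) he
    (fun i => coeFn_fourier_sqrtKinetic T ⟨w i, (w i).2.1⟩)
    (f := fun x => √(max 0 (-V x))) (aemeasurable_const.max hV.neg).sqrt
    (fun x => Real.sqrt_nonneg _) (fun i => ?_)
  · rw [Fintype.card_fin, hW'] at hcard
    refine hcard.trans (le_of_eq ?_)
    congr 1
    refine lintegral_congr fun x => ?_
    rw [Real.sqrt_eq_rpow, ← Real.rpow_mul (le_max_left _ _)]
    congr 2
    ring
  · have h1 : ‖A (w i)‖ = 1 := hAw.1 i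
    have hw0 : w i ≠ 0 := fun h => by simp [h] at h1
    have hlt : ‖A (w i)‖ < _ := norm_sqrtKinetic_lt_norm_sqrtNeg hE hφ hφE hw0 (hwW i)
    rw [h1] at hlt
    simp only [F, LinearIsometryEquiv.symm_apply_apply]
    rw [← enorm_sq_sqrtNeg V ⟨w i, (w i).2.2.2⟩]
    refine one_le_pow₀ ?_
    rw [← ofReal_norm, ENNReal.one_le_ofReal]
    exact hlt.le

/-! ### Counting eigenvalues with multiplicity -/

/-- Gram–Schmidt inside `W`. The bound through `Cardinal.toENat` also covers infinite-dimensional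
`W`, where every `n` is allowed. -/
lemma exists_orthonormal_mem {𝕜 H : Type*} [RCLike 𝕜] [NormedAddCommGroup H]
    [InnerProductSpace 𝕜 H] (W : Submodule 𝕜 H) {n : ℕ}
    (hn : (n : ℕ∞) ≤ Cardinal.toENat (Module.rank 𝕜 W)) :
    ∃ ψ : Fin n → H, Orthonormal 𝕜 ψ ∧ ∀ i, ψ i ∈ W := by
  obtain ⟨s, hs, hli⟩ := le_rank_iff_exists_linearIndependent_finset.1
    (Cardinal.natCast_le_toENat.1 hn)
  let v : Fin n → W := fun i => ((s.equivFinOfCardEq hs).symm i : W)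
  have hv : LinearIndependent 𝕜 v := hli.comp _ (s.equivFinOfCardEq hs).symm.injective
  refine ⟨fun i => (InnerProductSpace.gramSchmidtNormed 𝕜 v i : W),
    (InnerProductSpace.gramSchmidtNormed_orthonormal hv).comp_linearIsometry W.subtypeₗᵢ,
    fun i => Subtype.property _⟩

/-- To bound the number of negative eigenvalues, it suffices to bound the cardinality of finite
orthonormal families of eigenfunctions with negative eigenvalues. -/
lemma numNegEigenvalues_le_of_card_le {T V : Space d → ℝ} {C : ℝ≥0∞}
    (h : ∀ (J : Type) [Fintype J] (E : J → ℝ) (φ : J → L2 d), (∀ j, E j < 0) → Orthonormal ℂ φ →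
      (∀ j, φ j ∈ eigenspace T V (E j)) → (Fintype.card J : ℝ≥0∞) ≤ C) :
    numNegEigenvalues T V ≤ C := by
  rw [numNegEigenvalues, ENNReal.tsum_eq_iSup_sum]
  refine iSup_le fun s => ?_
  by_cases hr : ∀ E : {E : ℝ // E < 0}, Cardinal.toENat (Module.rank ℂ (eigenspace T V E)) ≠ ⊤
  · choose r hr using fun E => ENat.ne_top_iff_exists.1 (hr E)
    choose ψ hψ hψE using fun E : {E : ℝ // E < 0} =>
      exists_orthonormal_mem (eigenspace T V E) (hr E).le
    -- Bases of different eigenspaces combine, since distinct eigenvalues have orthogonal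
    -- eigenfunctions.
    have hφ : Orthonormal ℂ fun j : Σ E : s, Fin (r E) => ψ j.1 j.2 := by
      refine ⟨fun j => (hψ j.1).1 j.2, ?_⟩
      rintro ⟨E, i⟩ ⟨E', i'⟩ hne
      by_cases hEE : E = E'
      · subst hEE
        exact (hψ E).2 fun h => hne (Sigma.ext rfl (heq_of_eq h))
      · exact inner_eq_zero_of_mem_eigenspace
          (fun h => hEE (Subtype.ext (Subtype.ext h))) (hψE E i) (hψE E' i')
    have := h (Σ E : s, Fin (r E)) (fun j => ((j.1 : {E : ℝ // E < 0}) : ℝ)) _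
      (fun j => j.1.1.2) hφ (fun j => hψE j.1.1 j.2)
    refine le_trans (le_of_eq ?_) this
    rw [Fintype.card_sigma]
    simp only [Fintype.card_fin, ← hr]
    rw [Nat.cast_sum, Finset.sum_coe_sort s fun E => (r E : ℝ≥0∞)]
    rfl
  · push Not at hr
    obtain ⟨E, hE⟩ := hr
    -- An eigenspace of infinite dimension contains orthonormal families of every finite size, which
    -- forces the bound to be infinite.
    have hC : C = ∞ := by
      refine ENNReal.eq_top_of_forall_nnreal_le fun x => ?_
      obtain ⟨n, hxn⟩ := exists_nat_ge x
      obtain ⟨ψ, hψ, hψE⟩ := exists_orthonormal_mem (eigenspace T V E) (n := n)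
        (le_top.trans hE.ge)
      have := h _ (fun _ => (E : ℝ)) ψ (fun _ => E.2) hψ hψE
      rw [Fintype.card_fin] at this
      exact le_trans (by exact_mod_cast hxn) this
    rw [hC]
    exact le_top

end BoundStates

theorem theorem3p2 (d : ℕ) (γ : ℝ) (hγ : 0 < γ) (hγd : γ < d)
    (V : BoundStates.Space d → ℝ) (hV : AEMeasurable V volume)
    (hVc : BoundStates.IsRelFormCompact (fun η => ‖η‖ ^ γ) V) :
    BoundStates.numNegEigenvalues (fun η => ‖η‖ ^ γ) V ≤
      ENNReal.ofReal
        ((4 * (d : ℝ) / ((d : ℝ) - γ)) ^ (2 * (d : ℝ) / γ) *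
          ((d : ℝ) * ((d : ℝ) - γ) / (4 * γ) ^ 2) *
          (volume.real (Metric.ball (0 : BoundStates.Space d) 1) / (2 * Real.pi) ^ d)) *
        ∫⁻ x : BoundStates.Space d, ENNReal.ofReal (max 0 (-V x) ^ ((d : ℝ) / γ)) := by
  exact BoundStates.numNegEigenvalues_le_of_card_le fun J _ E φ hE hφ hφE =>
    BoundStates.card_le_of_eigenfunctions hγ hγd hV hE hφ hφE
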